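/- Let $\Gamma$ and $\Sigma$ be finite simple graphs with vertex sets $X$ and $Y$. Assume that $\Gamma$ is connected, that $\Sigma$ is regular with $|Y|\ge 2$, and that $\Gamma$ is pseudo-distance-regular around a vertex $x\in X$. The last condition means: there is an eigenvector $\alpha$ of the adjacency matrix of $\Gamma$ with all entries positive such that, for every $i\ge 0$ and every vertex $z$ at distance $i$ from $x$, each of the three sums $\sum_u \alpha_u/\alpha_z$, taken over the neighbours $u$ of $z$ at distance $i-1$, $i$, $i+1$ from $x$ respectively, depends only on $i$ and not on $z$. Let $H=H(\Gamma,\Sigma)$ be the graph obtained from the Cartesian product $\Gamma\,\square\,\Sigma$ by adding a new vertex $w$ that is adjacent exactly to the vertices $(x,y)$ with $y\in Y$. Let $V$ be the space of complex column vectors indexed by the vertices of $H$, let $E_i^*$ $(i\ge 0)$ be the diagonal matrix whose $(v,v)$-entry is $1$ if $v$ is at distance $i$ from $w$ in $H$ and $0$ otherwise, and let $T=T(w)$ be the algebra of complex matrices generated by the adjacency matrix of $H$ and all the $E_i^*$. A $T$-module is a subspace $W\subseteq V$ with $TW\subseteq W$. It is irreducible if $W\neq 0$ and its only $T$-submodules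 are $0$ and $W$. Its endpoint is the least $i$ with $E_i^*W\ne 0$, and it is thin if $\dim E_i^*W\le 1$ for all $i$. Two $T$-modules are isomorphic if there is a linear isomorphism between them that commutes with the action of $T$. Then the following are equivalent: (i) up to isomorphism, there is exactly one irreducible $T$-module with endpoint $1$, and this module is thin; (ii) $\Sigma$ is isomorphic to the empty graph $S_n$ on $n$ vertices for some $n\ge 2$, or to the complete graph $K_n$ for some $n\ge 2$. -/

import Mathlib

namespace TerwilligerGraph

open Matrix

section PseudoDistanceRegular

variable {V : Type*} [Fintype V]

open Classical in
/-- For a positive weight `α` on the vertices: the sum of `α u / α z` over all neighbours `u` of `z`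
whose distance to the base vertex `x` is `j`. -/
noncomputable def weightedCount (G : SimpleGraph V) (x : V) (α : V → ℝ) (z : V) (j : ℕ) : ℝ :=
  ∑ u : V, if G.Adj z u ∧ G.dist x u = j then α u / α z else 0

open Classical in
/-- Pseudo-distance-regularity of a connected graph around `x` (Fiol and Garriga). The weight `α` is
a positive eigenvector of the adjacency matrix; for a connected graph it is unique up to a positive
scalar, which the ratios `α u / α z` do not see. For `z` at distance `i` from `x` the three weighted
intersection numbers `c i`, `a i`, `b i` of `z` (neighbours at distance `i - 1`, `i`, `i + 1`
from `x`) depend only on `i`. -/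
def IsPseudoDistanceRegularAround (G : SimpleGraph V) (x : V) : Prop :=
  ∃ (α : V → ℝ) (ev : ℝ), (∀ v, 0 < α v) ∧ G.adjMatrix ℝ *ᵥ α = ev • α ∧
    ∃ c a b : ℕ → ℝ,
      (∀ (i : ℕ) (z : V), G.dist x z = i + 1 → weightedCount G x α z i = c (i + 1)) ∧
      (∀ (i : ℕ) (z : V), G.dist x z = i → weightedCount G x α z i = a i) ∧
      (∀ (i : ℕ) (z : V), G.dist x z = i → weightedCount G x α z (i + 1) = b i)

end PseudoDistanceRegular

section Terwilliger

variable {V : Type*} [Fintype V] [DecidableEq V]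

/-- The `i`-th dual idempotent with respect to `x`. In a connected graph it is the zero matrix
when `i` exceeds the eccentricity of `x`. -/
noncomputable def dualIdempotent (G : SimpleGraph V) (x : V) (i : ℕ) : Matrix V V ℂ :=
  Matrix.diagonal fun y => if G.dist x y = i then 1 else 0

open Classical in
/-- The Terwilliger algebra `T(x)`: the subalgebra of the full complex matrix algebra generated by
the adjacency matrix and the dual idempotents with respect to `x`. -/
noncomputable def terwilligerAlgebra (G : SimpleGraph V) (x : V) :
    Subalgebra ℂ (Matrix V V ℂ) :=
  Algebra.adjoin ℂ (insert (G.adjMatrix ℂ) (Set.range (dualIdempotent G x)))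

/-- `W` is a `T(x)`-module: a subspace of the standard module closed under the action of `T(x)`. -/
def IsTModule (G : SimpleGraph V) (x : V) (W : Submodule ℂ (V → ℂ)) : Prop :=
  ∀ B ∈ terwilligerAlgebra G x, ∀ v ∈ W, B *ᵥ v ∈ W

/-- `W` is an irreducible `T(x)`-module. -/
def IsIrreducibleTModule (G : SimpleGraph V) (x : V) (W : Submodule ℂ (V → ℂ)) : Prop :=
  IsTModule G x W ∧ W ≠ ⊥ ∧ ∀ U ≤ W, IsTModule G x U → U = ⊥ ∨ U = W

/-- The subspace `E_i^* W`. -/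
noncomputable def component (G : SimpleGraph V) (x : V) (i : ℕ) (W : Submodule ℂ (V → ℂ)) :
    Submodule ℂ (V → ℂ) :=
  W.map (dualIdempotent G x i).mulVecLin

/-- `W` has endpoint `r`: the least `i` with `E_i^* W ≠ 0` is `r`. -/
def HasEndpoint (G : SimpleGraph V) (x : V) (W : Submodule ℂ (V → ℂ)) (r : ℕ) : Prop :=
  IsLeast {i | component G x i W ≠ ⊥} r

/-- `W` is thin: every `E_i^* W` has dimension at most `1`. -/
def IsThin (G : SimpleGraph V) (x : V) (W : Submodule ℂ (V → ℂ)) : Prop :=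
  ∀ i : ℕ, Module.finrank ℂ (component G x i W) ≤ 1

/-- `W` and `W'` are `T(x)`-isomorphic: some linear isomorphism `σ : W → W'` satisfies
`σ (B u) = B (σ u)` for all `B ∈ T(x)` and `u ∈ W` (the variable `v` is the vector `B u` of `W`). -/
def TIsomorphic (G : SimpleGraph V) (x : V) (W W' : Submodule ℂ (V → ℂ)) : Prop :=
  ∃ σ : W ≃ₗ[ℂ] W', ∀ B ∈ terwilligerAlgebra G x, ∀ u v : W,
    (v : V → ℂ) = B *ᵥ (u : V → ℂ) → (σ v : V → ℂ) = B *ᵥ (σ u : V → ℂ)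

/-- Up to isomorphism there is exactly one irreducible `T(x)`-module with endpoint `1`, and it is
thin. -/
def HasUniqueThinEndpointOne (G : SimpleGraph V) (x : V) : Prop :=
  ∃ W : Submodule ℂ (V → ℂ),
    (IsIrreducibleTModule G x W ∧ HasEndpoint G x W 1) ∧ IsThin G x W ∧
      ∀ W' : Submodule ℂ (V → ℂ),
        IsIrreducibleTModule G x W' → HasEndpoint G x W' 1 → TIsomorphic G x W W'

end Terwilliger

section Construction

variable {X Y : Type*}

/-- The adjacency relation of `H(G, S)`; the new vertex `w` is `none`. -/
def coneAdj (G : SimpleGraph X) (S : SimpleGraph Y) (x : X) :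
    Option (X × Y) → Option (X × Y) → Prop
  | none, none => False
  | none, some q => q.1 = x
  | some p, none => p.1 = x
  | some p, some q => (G.boxProd S).Adj p q

/-- The graph `H(G, S)`: the Cartesian product of `G` and `S` together with a new vertex `none`
adjacent to exactly the vertices `(x, y)`, `y` a vertex of `S`. -/
def coneGraph (G : SimpleGraph X) (S : SimpleGraph Y) (x : X) : SimpleGraph (Option (X × Y)) where
  Adj := coneAdj G S x
  symm := ⟨by
    rintro (_ | p) (_ | q) h
    · exact h
    · exact h
    · exact h
    · exact SimpleGraph.Adj.symm (G := G.boxProd S) h⟩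
  loopless := ⟨by
    rintro (_ | p) h
    · exact h
    · exact (G.boxProd S).loopless.irrefl p h⟩

end Construction

end TerwilligerGraph

/-! If `v` on `Y` has sum zero and `A_S v = θ v`, consider the vectors `(z, y) ↦ f (dist x z) * α z
* v y` (`liftVec`). The new vertex sees only the sum of `v`, hence 0. Pseudo-distance-regularity
makes `G` act on `f` by a tridiagonal operator, and `S` adds `θ`. As the off-diagonal coefficients
do not vanish, these vectors form an irreducible thin module `R_v` with endpoint 1, whose
isomorphism class depends only on `θ`.

The class also determines `θ`: `E₁* A E₁*` acts on the first layer by a scalar that is `θ` plus a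
constant. A unique class therefore forces a single eigenvalue of `S` on sum-zero vectors. Regularity
and the spectral theorem then make `A_S` scalar there; testing on `e_y - e_y'` shows that all
off-diagonal entries of `A_S` agree, so `S` is empty or complete.

Conversely, if `A_S` is scalar on sum-zero vectors, a nonzero vector in the first layer of an
irreducible module with endpoint 1 is a lift of some such `u`, so the module is `R_u`
(`IsIrreducibleTModule.eq_range_liftVec`). -/

namespace TerwilligerGraph

open Matrix

/-! ### Distances from the new vertex -/

section Distance

variable {X Y : Type*} {G : SimpleGraph X} {S : SimpleGraph Y} {x : X}

/-- The embedding of `G` into the cone graph as the copy of `G` over the vertex `y` of `S`. -/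
def layerHom (G : SimpleGraph X) (S : SimpleGraph Y) (x : X) (y : Y) : G →g coneGraph G S x where
  toFun z := some (z, y)
  map_rel' h := SimpleGraph.boxProd_adj.2 (Or.inl ⟨h, rfl⟩)

/-- The height of a vertex of the cone graph above the new vertex. -/
noncomputable def coneHeight (G : SimpleGraph X) (x : X) : Option (X × Y) → ℕ
  | none => 0
  | some p => G.dist x p.1 + 1

theorem coneHeight_le_of_adj (hG : G.Connected) {p q : Option (X × Y)}
    (h : (coneGraph G S x).Adj p q) : coneHeight G x q ≤ coneHeight G x p + 1 := by
  rcases p with _ | p <;> rcases q with _ | q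
  · exact h.elim
  · have h' : q.1 = x := h
    simp [coneHeight, h']
  · simp [coneHeight]
  · rcases SimpleGraph.boxProd_adj.1 (show (G.boxProd S).Adj p q from h) with h' | h'
    · have h1 := hG.dist_triangle (u := x) (v := p.1) (w := q.1)
      rw [SimpleGraph.dist_eq_one_iff_adj.2 h'.1] at h1
      simpa [coneHeight] using h1
    · simp [coneHeight, h'.2]

theorem coneHeight_le_add_length (hG : G.Connected) {p q : Option (X × Y)}
    (W : (coneGraph G S x).Walk p q) : coneHeight G x q ≤ coneHeight G x p + W.length := by
  induction W with
  | nil => simp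
  | cons h W ih =>
    have := coneHeight_le_of_adj hG h
    rw [SimpleGraph.Walk.length_cons]
    omega

/-- A geodesic of `G` inside one layer gives the upper bound; the lower bound holds because the
height rises by at most one along each edge. -/
theorem coneGraph_dist_some (hG : G.Connected) (z : X) (y : Y) :
    (coneGraph G S x).dist none (some (z, y)) = G.dist x z + 1 := by
  obtain ⟨W, hW⟩ := hG.exists_walk_length_eq_dist x z
  have hadj : (coneGraph G S x).Adj none (layerHom G S x y x) := (rfl : x = x)
  let W' : (coneGraph G S x).Walk none (some (z, y)) :=
    SimpleGraph.Walk.cons hadj (W.map (layerHom G S x y))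
  have hW' : W'.length = G.dist x z + 1 := 
    congrArg (· + 1) ((SimpleGraph.Walk.length_map _ _).trans hW)
  refine le_antisymm (hW' ▸ SimpleGraph.dist_le W') ?_
  obtain ⟨W₂, hW₂⟩ := W'.reachable.exists_walk_length_eq_dist
  rw [← hW₂]
  simpa [coneHeight] using coneHeight_le_add_length hG W₂

theorem exists_adj_dist_eq (hG : G.Connected) {z : X} {i : ℕ}
    (h : G.dist x z = i + 1) : ∃ u, G.Adj z u ∧ G.dist x u = i := by
  obtain ⟨W, hW⟩ := hG.exists_walk_length_eq_dist z x
  rw [SimpleGraph.dist_comm, h] at hW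
  cases W with
  | nil => simp at hW
  | cons hadj W =>
    rename_i u
    rw [SimpleGraph.Walk.length_cons] at hW
    refine ⟨u, hadj, ?_⟩
    have h1 := SimpleGraph.dist_le W
    rw [SimpleGraph.dist_comm] at h1
    have h2 := hG.dist_triangle (u := x) (v := u) (w := z)
    rw [SimpleGraph.dist_eq_one_iff_adj.2 hadj.symm] at h2
    omega

end Distance

/-! ### The adjacency operator in coordinates -/

section NeighbourSums

variable {X Y : Type*} [Fintype X] [Fintype Y]

open Classical in
theorem coneGraph_mulVec_none (G : SimpleGraph X) (S : SimpleGraph Y) (x : X)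
    (g : Option (X × Y) → ℂ) :
    ((coneGraph G S x).adjMatrix ℂ *ᵥ g) none = ∑ y, g (some (x, y)) := by
  have h : ∀ p : X × Y, (coneGraph G S x).Adj none (some p) ↔ p.1 = x := fun _ => Iff.rfl
  simp only [Matrix.mulVec, dotProduct, SimpleGraph.adjMatrix_apply, Fintype.sum_option,
    Fintype.sum_prod_type, h]
  rw [Finset.sum_eq_single x] <;> simp +contextual

open Classical in
theorem coneGraph_mulVec_some (G : SimpleGraph X) (S : SimpleGraph Y) [DecidableRel S.Adj] (x : X)
    (g : Option (X × Y) → ℂ) (z : X) (y : Y) :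
    ((coneGraph G S x).adjMatrix ℂ *ᵥ g) (some (z, y)) =
      (if z = x then g none else 0) + (∑ u, if G.Adj z u then g (some (u, y)) else 0) +
        (S.adjMatrix ℂ *ᵥ fun y' => g (some (z, y'))) y := by
  have h : ∀ p : X × Y, (coneGraph G S x).Adj (some (z, y)) (some p) ↔
      G.Adj z p.1 ∧ y = p.2 ∨ S.Adj y p.2 ∧ z = p.1 := fun _ => SimpleGraph.boxProd_adj
  have h0 : (coneGraph G S x).Adj (some (z, y)) none ↔ z = x := Iff.rfl
  -- Irreflexivity makes the two kinds of product edge exclusive, so the indicator splits as a sum.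
  have hterm : ∀ u y', (if G.Adj z u ∧ y = y' ∨ S.Adj y y' ∧ z = u then (1 : ℂ) else 0) *
      g (some (u, y')) = (if y = y' then (if G.Adj z u then g (some (u, y')) else 0) else 0) +
        (if z = u then (if S.Adj y y' then g (some (u, y')) else 0) else 0) := by
    intro u y'
    by_cases h1 : y = y' <;> by_cases h2 : z = u <;> subst_vars <;> simp [*]
  simp only [Matrix.mulVec, dotProduct, SimpleGraph.adjMatrix_apply, Fintype.sum_option,
    Fintype.sum_prod_type, h, h0, hterm, Finset.sum_add_distrib]
  rw [Finset.sum_comm (f := fun u y' => if z = u then _ else _)]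
  simp [add_assoc]

end NeighbourSums

/-! ### Pseudo-distance-regularity as a tridiagonal action -/

section Weights

variable {X : Type*} [Fintype X]

/-- The tridiagonal operator on sequences with coefficients `c`, `a`, `b`. -/
def tridiagonal (c a b : ℕ → ℂ) (f : ℕ → ℂ) (j : ℕ) : ℂ :=
  c j * f (j - 1) + a j * f j + b j * f (j + 1)

open Classical in
/-- On functions `u ↦ f (dist x u) * α u` the adjacency operator of `G` acts by a tridiagonal
operator on `f` that is irreducible on the set of distances from `x`. -/
structure ActsTridiagonally (G : SimpleGraph X) (x : X) (α : X → ℂ) (c a b : ℕ → ℂ) : Prop where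
  weight_ne_zero : ∀ z, α z ≠ 0
  sum_adj : ∀ (z : X) (f : ℕ → ℂ), (∑ u, if G.Adj z u then f (G.dist x u) * α u else 0) =
    tridiagonal c a b f (G.dist x z) * α z
  lower_ne_zero : ∀ z i, G.dist x z = i + 1 → c (i + 1) ≠ 0
  upper_ne_zero : ∀ z i, G.dist x z = i + 1 → b i ≠ 0

theorem weightedCount_pos {G : SimpleGraph X} {x z u : X} {α : X → ℝ} (hα : ∀ v, 0 < α v)
    (h : G.Adj z u) : 0 < weightedCount G x α z (G.dist x u) := by
  classical
  refine Finset.sum_pos' (fun v _ => ?_) ⟨u, Finset.mem_univ u, ?_⟩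
  · split_ifs
    · exact (div_pos (hα v) (hα z)).le
    · exact le_rfl
  · rw [if_pos ⟨h, rfl⟩]
    exact div_pos (hα u) (hα z)

open Classical in
theorem weightedCount_mul {G : SimpleGraph X} {x : X} {α : X → ℝ} (hα : ∀ v, 0 < α v) (z : X)
    (j : ℕ) : (weightedCount G x α z j : ℂ) * (α z : ℂ) =
      ∑ u, if G.Adj z u ∧ G.dist x u = j then (α u : ℂ) else 0 := by
  have hz : (α z : ℂ) ≠ 0 := by exact_mod_cast (hα z).ne'
  unfold weightedCount
  push_cast
  rw [Finset.sum_mul]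
  refine Finset.sum_congr rfl fun u _ => ?_
  split_ifs
  · push_cast
    field_simp
  · simp

theorem IsPseudoDistanceRegularAround.exists_actsTridiagonally {G : SimpleGraph X}
    (hG : G.Connected) {x : X} (hx : IsPseudoDistanceRegularAround G x) :
    ∃ (α : X → ℂ) (c a b : ℕ → ℂ), ActsTridiagonally G x α c a b := by
  classical
  obtain ⟨α, -, hα, -, c, a, b, hc, ha, hb⟩ := hx
  -- In `tridiagonal`, `f (0 - 1)` is `f 0`; setting `c 0 = 0` removes this spurious term.
  refine ⟨fun z => (α z : ℂ), fun j => if j = 0 then 0 else (c j : ℂ), fun j => (a j : ℂ),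
    fun j => (b j : ℂ), fun z => by exact_mod_cast (hα z).ne', fun z f => ?_, fun z i h => ?_,
    fun z i h => ?_⟩
  · have hdist : ∀ u, G.Adj z u →
        G.dist x u + 1 = G.dist x z ∨ G.dist x u = G.dist x z ∨ G.dist x u = G.dist x z + 1 := by
      intro u hu
      have h1 := hG.dist_triangle (u := x) (v := u) (w := z)
      have h2 := hG.dist_triangle (u := x) (v := z) (w := u)
      rw [SimpleGraph.dist_eq_one_iff_adj.2 hu.symm] at h1
      rw [SimpleGraph.dist_eq_one_iff_adj.2 hu] at h2
      omega
    have ha' := weightedCount_mul (G := G) (x := x) hα z (G.dist x z)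
    have hb' := weightedCount_mul (G := G) (x := x) hα z (G.dist x z + 1)
    rw [ha _ z rfl] at ha'
    rw [hb _ z rfl] at hb'
    unfold tridiagonal
    rcases hj : G.dist x z with _ | i
    · rw [hj] at ha' hb' hdist
      have : ∀ u, (if G.Adj z u then f (G.dist x u) * (α u : ℂ) else 0) =
          f 0 * (if G.Adj z u ∧ G.dist x u = 0 then (α u : ℂ) else 0) +
          f 1 * (if G.Adj z u ∧ G.dist x u = 0 + 1 then (α u : ℂ) else 0) := by
        intro u
        by_cases hu : G.Adj z u
        · rcases hdist u hu with h | h | h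
          · omega
          · simp [hu, h]
          · simp [hu, h]
        · simp [hu]
      simp only [this, Finset.sum_add_distrib, ← Finset.mul_sum, ← ha', ← hb']
      simp
      ring
    · have hc' := weightedCount_mul (G := G) (x := x) hα z i
      rw [hc i z hj] at hc'
      rw [hj] at ha' hb' hdist
      have : ∀ u, (if G.Adj z u then f (G.dist x u) * (α u : ℂ) else 0) =
          f i * (if G.Adj z u ∧ G.dist x u = i then (α u : ℂ) else 0) +
          f (i + 1) * (if G.Adj z u ∧ G.dist x u = i + 1 then (α u : ℂ) else 0) +
          f (i + 1 + 1) * (if G.Adj z u ∧ G.dist x u = i + 1 + 1 then (α u : ℂ) else 0) := by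
        intro u
        by_cases hu : G.Adj z u
        · rcases hdist u hu with h | h | h
          · have h : G.dist x u = i := by omega
            simp [hu, h]
            omega
          · simp [hu, h]
          · simp [hu, h]
            omega
        · simp [hu]
      simp only [this, Finset.sum_add_distrib, ← Finset.mul_sum, ← ha', ← hb', ← hc']
      simp
      ring
  · obtain ⟨u, hu, hui⟩ := exists_adj_dist_eq hG h
    have := weightedCount_pos (x := x) hα hu
    rw [hui, hc i z h] at this
    simpa using this.ne'
  · obtain ⟨u, hu, hui⟩ := exists_adj_dist_eq hG h
    have := weightedCount_pos (x := x) hα hu.symm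
    rw [h, hb i u hui] at this
    simpa using this.ne'

end Weights

/-! ### Separated vectors -/

section Lift

variable {X Y : Type*}

/-- The vector on the cone graph that vanishes at the new vertex and takes the value
`f (dist x z) * α z * v y` at `(z, y)`. -/
noncomputable def liftVec (G : SimpleGraph X) (x : X) (α : X → ℂ) (v : Y → ℂ) :
    (ℕ → ℂ) →ₗ[ℂ] (Option (X × Y) → ℂ) where
  toFun f o := o.elim 0 fun p => f (G.dist x p.1) * α p.1 * v p.2
  map_add' f g := by
    ext (_ | p) <;> simp [add_mul]
  map_smul' r f := by
    ext (_ | p) <;> simp [mul_assoc]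

variable {G : SimpleGraph X} {x : X} {α : X → ℂ} {v : Y → ℂ}

@[simp]
theorem liftVec_none (f : ℕ → ℂ) : liftVec G x α v f none = 0 := rfl

@[simp]
theorem liftVec_some (f : ℕ → ℂ) (z : X) (y : Y) :
    liftVec G x α v f (some (z, y)) = f (G.dist x z) * α z * v y := rfl

theorem liftVec_ne_zero (hα : ∀ z, α z ≠ 0) (hv : v ≠ 0) {f : ℕ → ℂ} {z : X}
    (hf : f (G.dist x z) ≠ 0) : liftVec G x α v f ≠ 0 := by
  obtain ⟨y, hy⟩ := Function.ne_iff.1 hv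
  exact Function.ne_iff.2 ⟨some (z, y), mul_ne_zero (mul_ne_zero hf (hα z)) hy⟩

/-- Sequences live on all of `ℕ`, but a lift sees only the distances that occur. -/
theorem liftVec_congr {f g : ℕ → ℂ} (h : ∀ z, f (G.dist x z) = g (G.dist x z)) :
    liftVec G x α v f = liftVec G x α v g := by
  ext (_ | ⟨z, y⟩)
  · rfl
  · simp [h]

theorem liftVec_single_eq_zero {i : ℕ} (h : ∀ z, G.dist x z ≠ i) :
    liftVec G x α v (Pi.single i 1) = 0 := by
  rw [liftVec_congr (g := 0) fun z => by simp [h z], map_zero]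

end Lift

/-! ### The irreducible modules attached to centered eigenvectors -/

section Action

variable {V : Type*} [Fintype V] [DecidableEq V]

open Classical in
theorem adjMatrix_mem_terwilligerAlgebra (H : SimpleGraph V) (w : V) :
    H.adjMatrix ℂ ∈ terwilligerAlgebra H w :=
  Algebra.subset_adjoin (Set.mem_insert _ _)

theorem dualIdempotent_mem_terwilligerAlgebra (H : SimpleGraph V) (w : V) (i : ℕ) :
    dualIdempotent H w i ∈ terwilligerAlgebra H w :=
  Algebra.subset_adjoin (Set.mem_insert_of_mem _ ⟨i, rfl⟩)

theorem dualIdempotent_mulVec_apply (H : SimpleGraph V) (w : V) (i : ℕ) (g : V → ℂ) (p : V) :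
    (dualIdempotent H w i *ᵥ g) p = if H.dist w p = i then g p else 0 := by
  simp [dualIdempotent, Matrix.mulVec_diagonal]

variable {X Y : Type*} [Fintype X] [Fintype Y]
  {G : SimpleGraph X} {S : SimpleGraph Y} {x : X}
  {α : X → ℂ} {c a b : ℕ → ℂ} {θ : ℂ} {v : Y → ℂ}

/-- `v` is a `θ`-eigenvector of `S` (or zero) that is orthogonal to the all-ones vector. -/
def IsCenteredEigenvector (S : SimpleGraph Y) [DecidableRel S.Adj] (θ : ℂ) (v : Y → ℂ) : Prop :=
  S.adjMatrix ℂ *ᵥ v = θ • v ∧ ∑ y, v y = 0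

open Classical in
theorem adjMatrix_mulVec_liftVec [DecidableRel S.Adj] (hT : ActsTridiagonally G x α c a b)
    (hv : IsCenteredEigenvector S θ v) (f : ℕ → ℂ) :
    (coneGraph G S x).adjMatrix ℂ *ᵥ liftVec G x α v f =
      liftVec G x α v (tridiagonal c a b f + θ • f) := by
  ext (_ | ⟨z, y⟩)
  · rw [coneGraph_mulVec_none]
    simp [← Finset.mul_sum, hv.2]
  · have h1 : ∀ u, (if G.Adj z u then liftVec G x α v f (some (u, y)) else 0) =
        (if G.Adj z u then f (G.dist x u) * α u else 0) * v y := by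
      intro u
      split_ifs <;> simp
    have h2 : (fun y' => liftVec G x α v f (some (z, y'))) = (f (G.dist x z) * α z) • v := rfl
    rw [coneGraph_mulVec_some, h2, Matrix.mulVec_smul, hv.1]
    simp only [h1, ← Finset.sum_mul, hT.sum_adj]
    simp
    ring

variable [DecidableEq X] [DecidableEq Y]

theorem dualIdempotent_mulVec_liftVec (hG : G.Connected) (i : ℕ) (f : ℕ → ℂ) :
    dualIdempotent (coneGraph G S x) none i *ᵥ liftVec G x α v f =
      liftVec G x α v fun j => if j + 1 = i then f j else 0 := by
  ext (_ | ⟨z, y⟩)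
  · simp [dualIdempotent_mulVec_apply]
  · simp [dualIdempotent_mulVec_apply, coneGraph_dist_some hG]

theorem dualIdempotent_succ_mulVec_liftVec (hG : G.Connected) (i : ℕ) (f : ℕ → ℂ) :
    dualIdempotent (coneGraph G S x) none (i + 1) *ᵥ liftVec G x α v f =
      f i • liftVec G x α v (Pi.single i 1) := by
  rw [dualIdempotent_mulVec_liftVec hG, ← map_smul]
  congr 1
  ext j
  by_cases h : j = i <;> simp [h]

theorem dualIdempotent_zero_mulVec_liftVec (hG : G.Connected) (f : ℕ → ℂ) :
    dualIdempotent (coneGraph G S x) none 0 *ᵥ liftVec G x α v f = 0 := by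
  rw [dualIdempotent_mulVec_liftVec hG, liftVec_congr (g := 0) fun z => by simp, map_zero]

theorem hasEndpoint_range_liftVec (hG : G.Connected) (hα : ∀ z, α z ≠ 0) (hv0 : v ≠ 0) :
    HasEndpoint (coneGraph G S x) none (LinearMap.range (liftVec G x α v)) 1 := by
  constructor
  · refine (Submodule.ne_bot_iff _).2 ⟨_, ⟨_, ⟨1, rfl⟩, rfl⟩, ?_⟩
    rw [Matrix.mulVecLin_apply, dualIdempotent_mulVec_liftVec hG]
    exact liftVec_ne_zero (z := x) hα hv0 (by simp)
  · intro i hi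
    refine Nat.one_le_iff_ne_zero.2 ?_
    rintro rfl
    refine hi ((Submodule.eq_bot_iff _).2 ?_)
    rintro _ ⟨_, ⟨f, rfl⟩, rfl⟩
    rw [Matrix.mulVecLin_apply, dualIdempotent_zero_mulVec_liftVec hG]

theorem isThin_range_liftVec (hG : G.Connected) :
    IsThin (coneGraph G S x) none (LinearMap.range (liftVec G x α v)) := by
  intro i
  have hle : component (coneGraph G S x) none i (LinearMap.range (liftVec G x α v)) ≤
      Submodule.span ℂ {liftVec G x α v (Pi.single (i - 1) 1)} := by
    rintro _ ⟨_, ⟨f, rfl⟩, rfl⟩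
    rw [Matrix.mulVecLin_apply]
    rcases i with _ | i
    · rw [dualIdempotent_zero_mulVec_liftVec hG]
      exact Submodule.zero_mem _
    · rw [dualIdempotent_succ_mulVec_liftVec hG]
      exact Submodule.smul_mem _ _ (Submodule.mem_span_singleton_self _)
  refine (Submodule.finrank_mono hle).trans ((finrank_span_le_card (R := ℂ) _).trans ?_)
  simp

theorem IsTModule.smul_liftVec_single_mem {U : Submodule ℂ (Option (X × Y) → ℂ)}
    (hU : IsTModule (coneGraph G S x) none U) (hG : G.Connected) {f : ℕ → ℂ}
    (hf : liftVec G x α v f ∈ U) (i : ℕ) : f i • liftVec G x α v (Pi.single i 1) ∈ U := by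
  rw [← dualIdempotent_succ_mulVec_liftVec (S := S) hG]
  exact hU _ (dualIdempotent_mem_terwilligerAlgebra _ _ _) _ hf

variable [DecidableRel S.Adj]

/-- The point is the quantifier order: one `φ` serves every centered `θ`-eigenvector, so modules
with the same `θ` are isomorphic. -/
theorem terwilligerAlgebra_mulVec_liftVec (hG : G.Connected) (hT : ActsTridiagonally G x α c a b)
    (θ : ℂ) {B : Matrix (Option (X × Y)) (Option (X × Y)) ℂ}
    (hB : B ∈ terwilligerAlgebra (coneGraph G S x) none) :
    ∃ φ : (ℕ → ℂ) → ℕ → ℂ, ∀ v, IsCenteredEigenvector S θ v → ∀ f,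
      B *ᵥ liftVec G x α v f = liftVec G x α v (φ f) := by
  classical
  induction hB using Algebra.adjoin_induction with
  | mem B hB =>
    rcases hB with rfl | ⟨i, rfl⟩
    · exact ⟨fun f => tridiagonal c a b f + θ • f, fun v hv f => adjMatrix_mulVec_liftVec hT hv f⟩
    · exact ⟨_, fun v _ f => dualIdempotent_mulVec_liftVec hG i f⟩
  | algebraMap r =>
    refine ⟨fun f => r • f, fun v _ f => ?_⟩
    rw [Algebra.algebraMap_eq_smul_one, Matrix.smul_mulVec, Matrix.one_mulVec, map_smul]
  | add B C _ _ hB hC =>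
    obtain ⟨φ, hφ⟩ := hB
    obtain ⟨ψ, hψ⟩ := hC
    exact ⟨fun f => φ f + ψ f, fun v hv f => by
      rw [Matrix.add_mulVec, hφ v hv, hψ v hv, map_add]⟩
  | mul B C _ _ hB hC =>
    obtain ⟨φ, hφ⟩ := hB
    obtain ⟨ψ, hψ⟩ := hC
    exact ⟨fun f => φ (ψ f), fun v hv f => by
      rw [← Matrix.mulVec_mulVec, hψ v hv, hφ v hv]⟩

theorem isTModule_range_liftVec (hG : G.Connected) (hT : ActsTridiagonally G x α c a b)
    (hv : IsCenteredEigenvector S θ v) :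
    IsTModule (coneGraph G S x) none (LinearMap.range (liftVec G x α v)) := by
  rintro B hB _ ⟨f, rfl⟩
  obtain ⟨φ, hφ⟩ := terwilligerAlgebra_mulVec_liftVec hG hT θ hB
  exact ⟨φ f, (hφ v hv f).symm⟩

theorem IsTModule.liftVec_tridiagonal_mem {U : Submodule ℂ (Option (X × Y) → ℂ)}
    (hU : IsTModule (coneGraph G S x) none U) (hT : ActsTridiagonally G x α c a b)
    (hv : IsCenteredEigenvector S θ v) {f : ℕ → ℂ} (hf : liftVec G x α v f ∈ U) :
    liftVec G x α v (tridiagonal c a b f + θ • f) ∈ U := by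
  classical
  rw [← adjMatrix_mulVec_liftVec hT hv]
  exact hU _ (adjMatrix_mem_terwilligerAlgebra _ _) _ hf

/-- Applying `A` and projecting moves up one layer with factor `c (i + 1) ≠ 0`; layers at distances
that do not occur lift to zero. -/
theorem IsTModule.range_liftVec_le {U : Submodule ℂ (Option (X × Y) → ℂ)}
    (hU : IsTModule (coneGraph G S x) none U) (hG : G.Connected)
    (hT : ActsTridiagonally G x α c a b) (hv : IsCenteredEigenvector S θ v)
    (h0 : liftVec G x α v (Pi.single 0 1) ∈ U) : LinearMap.range (liftVec G x α v) ≤ U := by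
  have hsingle : ∀ i, liftVec G x α v (Pi.single i 1) ∈ U := by
    intro i
    induction i with
    | zero => exact h0
    | succ i ih =>
      by_cases hz : ∃ z, G.dist x z = i + 1
      · obtain ⟨z, hz⟩ := hz
        have h := hU.smul_liftVec_single_mem hG (hU.liftVec_tridiagonal_mem hT hv ih) (i + 1)
        refine (U.smul_mem_iff ?_).1 h
        have hi : i + 1 + 1 ≠ i := by omega
        simpa [tridiagonal, Pi.single_apply, hi] using hT.lower_ne_zero z i hz
      · push Not at hz
        rw [liftVec_single_eq_zero hz]
        exact U.zero_mem
  rintro _ ⟨f, rfl⟩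
  have hf : liftVec G x α v f = liftVec G x α v
      (∑ i ∈ Finset.univ.image (G.dist x), f i • Pi.single i (1 : ℂ)) := by
    refine liftVec_congr fun z => ?_
    rw [Finset.sum_apply, Finset.sum_eq_single (G.dist x z)]
    · simp
    · intro i _ hi
      simp [hi.symm]
    · intro h
      exact (h (Finset.mem_image_of_mem _ (Finset.mem_univ z))).elim
  rw [hf, map_sum]
  refine U.sum_mem fun i _ => ?_
  rw [map_smul]
  exact U.smul_mem _ (hsingle i)

/-- A nonzero vector has a nonzero layer; the factors `b i ≠ 0` bring it down to layer 0, which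
generates everything. -/
theorem isIrreducibleTModule_range_liftVec (hG : G.Connected)
    (hT : ActsTridiagonally G x α c a b) (hv : IsCenteredEigenvector S θ v) (hv0 : v ≠ 0) :
    IsIrreducibleTModule (coneGraph G S x) none (LinearMap.range (liftVec G x α v)) := by
  refine ⟨isTModule_range_liftVec hG hT hv, ?_, fun U hUW hU => ?_⟩
  · refine (Submodule.ne_bot_iff _).2 ⟨_, ⟨1, rfl⟩, ?_⟩
    exact liftVec_ne_zero (z := x) hT.weight_ne_zero hv0 one_ne_zero
  · refine or_iff_not_imp_left.2 fun hU0 => le_antisymm hUW ?_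
    refine hU.range_liftVec_le hG hT hv ?_
    obtain ⟨g, hg, hg0⟩ := (Submodule.ne_bot_iff _).1 hU0
    obtain ⟨f, rfl⟩ := hUW hg
    have hz : ∃ z, f (G.dist x z) ≠ 0 := by
      by_contra! h
      exact hg0 (by rw [liftVec_congr (g := 0) h, map_zero])
    obtain ⟨z, hz⟩ := hz
    have hdesc : ∀ i z, G.dist x z = i → liftVec G x α v (Pi.single i 1) ∈ U →
        liftVec G x α v (Pi.single 0 1) ∈ U := by
      intro i
      induction i with
      | zero => exact fun _ _ h => h
      | succ i ih =>
        intro z hz h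
        obtain ⟨u, -, hu⟩ := exists_adj_dist_eq hG hz
        refine ih u hu ?_
        have h := hU.smul_liftVec_single_mem hG (hU.liftVec_tridiagonal_mem hT hv h) i
        refine (U.smul_mem_iff ?_).1 h
        have hi : i - 1 ≠ i + 1 := by omega
        simpa [tridiagonal, Pi.single_apply, hi] using hT.upper_ne_zero z i hz
    exact hdesc _ z rfl ((U.smul_mem_iff hz).1 (hU.smul_liftVec_single_mem hG hg _))

end Action

/-! ### Isomorphism classes and the local eigenvalue -/

section Isomorphism

variable {X Y : Type*}

/-- The linear map that sends `g` to `(z, y) ↦ g (z, y₀) * u y`. -/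
def transferMap (X : Type*) (y₀ : Y) (u : Y → ℂ) :
    (Option (X × Y) → ℂ) →ₗ[ℂ] (Option (X × Y) → ℂ) where
  toFun g o := o.elim 0 fun p => g (some (p.1, y₀)) * u p.2
  map_add' f g := by
    ext (_ | p) <;> simp [add_mul]
  map_smul' r f := by
    ext (_ | p) <;> simp [mul_assoc]

theorem transferMap_liftVec {G : SimpleGraph X} {x : X} {α : X → ℂ} {v : Y → ℂ} {y₀ : Y}
    (hy₀ : v y₀ ≠ 0) (u : Y → ℂ) (f : ℕ → ℂ) :
    transferMap X y₀ ((v y₀)⁻¹ • u) (liftVec G x α v f) = liftVec G x α u f := by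
  ext (_ | ⟨z, y⟩)
  · rfl
  · change f (G.dist x z) * α z * v y₀ * ((v y₀)⁻¹ * u y) = f (G.dist x z) * α z * u y
    field_simp

/-- A lift does not determine `f` off the occurring distances, so `σ` is built from `transferMap`,
which needs no choice of `f`. -/
theorem exists_equiv_range_liftVec (G : SimpleGraph X) (x : X) (α : X → ℂ) {v u : Y → ℂ}
    (hv : v ≠ 0) (hu : u ≠ 0) :
    ∃ σ : LinearMap.range (liftVec G x α v) ≃ₗ[ℂ] LinearMap.range (liftVec G x α u),
      ∀ (w : LinearMap.range (liftVec G x α v)) (f : ℕ → ℂ), (w : Option (X × Y) → ℂ) = liftVec G x α v f →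
        (σ w : Option (X × Y) → ℂ) = liftVec G x α u f := by
  obtain ⟨y, hy⟩ := Function.ne_iff.1 hv
  obtain ⟨y', hy'⟩ := Function.ne_iff.1 hu
  refine ⟨LinearEquiv.ofLinearMap
    ((transferMap X y ((v y)⁻¹ • u)).restrict ?_)
    ((transferMap X y' ((u y')⁻¹ • v)).restrict ?_) ?_ ?_, ?_⟩
  · rintro _ ⟨f, rfl⟩
    exact ⟨f, (transferMap_liftVec hy u f).symm⟩
  · rintro _ ⟨f, rfl⟩
    exact ⟨f, (transferMap_liftVec hy' v f).symm⟩
  · ext1 ⟨_, f, rfl⟩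
    refine Subtype.ext ?_
    change transferMap X y _ (transferMap X y' _ (liftVec G x α u f)) = liftVec G x α u f
    rw [transferMap_liftVec hy', transferMap_liftVec hy]
  · ext1 ⟨_, f, rfl⟩
    refine Subtype.ext ?_
    change transferMap X y' _ (transferMap X y _ (liftVec G x α v f)) = liftVec G x α v f
    rw [transferMap_liftVec hy, transferMap_liftVec hy']
  · intro w f hw
    change transferMap X y _ (w : Option (X × Y) → ℂ) = _
    rw [hw, transferMap_liftVec hy]

variable [Fintype X] [Fintype Y] [DecidableEq X] [DecidableEq Y]
  {G : SimpleGraph X} {S : SimpleGraph Y} [DecidableRel S.Adj] {x : X}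
  {α : X → ℂ} {c a b : ℕ → ℂ} {θ : ℂ}

theorem tIsomorphic_range_liftVec (hG : G.Connected) (hT : ActsTridiagonally G x α c a b)
    {v u : Y → ℂ} (hv : IsCenteredEigenvector S θ v) (hu : IsCenteredEigenvector S θ u)
    (hv0 : v ≠ 0) (hu0 : u ≠ 0) :
    TIsomorphic (coneGraph G S x) none (LinearMap.range (liftVec G x α v))
      (LinearMap.range (liftVec G x α u)) := by
  obtain ⟨σ, hσ⟩ := exists_equiv_range_liftVec G x α hv0 hu0
  refine ⟨σ, ?_⟩
  rintro B hB ⟨_, f, rfl⟩ w hw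
  obtain ⟨φ, hφ⟩ := terwilligerAlgebra_mulVec_liftVec hG hT θ hB
  refine (hσ w (φ f) (hw.trans (hφ v hv f))).trans ?_
  exact ((congrArg (B *ᵥ ·) (hσ ⟨_, f, rfl⟩ f rfl)).trans (hφ u hu f)).symm

theorem IsIrreducibleTModule.eq_range_liftVec {W : Submodule ℂ (Option (X × Y) → ℂ)}
    (hW : IsIrreducibleTModule (coneGraph G S x) none W)
    (hend : HasEndpoint (coneGraph G S x) none W 1) (hG : G.Connected)
    (hT : ActsTridiagonally G x α c a b)
    (hS : ∀ u : Y → ℂ, ∑ y, u y = 0 → S.adjMatrix ℂ *ᵥ u = θ • u) :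
    ∃ u : Y → ℂ, IsCenteredEigenvector S θ u ∧ u ≠ 0 ∧ W = LinearMap.range (liftVec G x α u) := by
  classical
  have hnone : ∀ g ∈ W, g none = 0 := by
    intro g hg
    have h0 : component (coneGraph G S x) none 0 W = ⊥ := by
      by_contra h
      exact absurd (hend.2 h) (by norm_num)
    have h1 : dualIdempotent (coneGraph G S x) none 0 *ᵥ g = 0 :=
      (Submodule.eq_bot_iff _).1 h0 _ ⟨g, hg, rfl⟩
    simpa [dualIdempotent_mulVec_apply] using congrFun h1 none
  obtain ⟨_, ⟨g, hg, rfl⟩, hg0⟩ := (Submodule.ne_bot_iff _).1 hend.1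
  rw [Matrix.mulVecLin_apply] at hg0
  have hEg : dualIdempotent (coneGraph G S x) none 1 *ᵥ g ∈ W :=
    hW.1 _ (dualIdempotent_mem_terwilligerAlgebra _ _ _) _ hg
  -- The first layer is `{x} × Y`; the factor `(α x)⁻¹` cancels the weight.
  have hlift : dualIdempotent (coneGraph G S x) none 1 *ᵥ g =
      liftVec G x α (fun y => (α x)⁻¹ * g (some (x, y))) (Pi.single 0 1) := by
    ext (_ | ⟨z, y⟩)
    · simp [dualIdempotent_mulVec_apply]
    · rw [dualIdempotent_mulVec_apply, coneGraph_dist_some hG, liftVec_some]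
      by_cases hz : x = z
      · subst hz
        simp [mul_inv_cancel_left₀ (hT.weight_ne_zero x)]
      · have : G.dist x z ≠ 0 := fun h => hz (hG.dist_eq_zero_iff.1 h)
        simp [this]
  rw [hlift] at hEg hg0
  -- The entry of `A` times this lift at the new vertex is `α x` times the sum, and vectors of `W`
  -- vanish there.
  have hsum : ∑ y, (α x)⁻¹ * g (some (x, y)) = 0 := by
    have h := hnone _ (hW.1 _ (adjMatrix_mem_terwilligerAlgebra _ _) _ hEg)
    rw [coneGraph_mulVec_none] at h
    simp only [liftVec_some, SimpleGraph.dist_self, Pi.single_eq_same, one_mul,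
      ← Finset.mul_sum] at h
    rw [← Finset.mul_sum]
    exact (mul_eq_zero.1 h).resolve_left (hT.weight_ne_zero x)
  have hu : IsCenteredEigenvector S θ (fun y => (α x)⁻¹ * g (some (x, y))) := ⟨hS _ hsum, hsum⟩
  have hu0 : (fun y => (α x)⁻¹ * g (some (x, y))) ≠ 0 := by
    intro h
    refine hg0 ?_
    rw [h]
    ext (_ | ⟨z, y⟩) <;> simp
  refine ⟨_, hu, hu0, ?_⟩
  have hle := hW.1.range_liftVec_le hG hT hu hEg
  exact ((hW.2.2 _ hle (isTModule_range_liftVec hG hT hu)).resolve_left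
    (isIrreducibleTModule_range_liftVec hG hT hu hu0).2.1).symm

open Classical in
/-- The local adjacency operator on the first subconstituent acts on a module isomorphic to the
lift of a centered `θ`-eigenvector as the scalar `c 0 + a 0 + θ`. -/
theorem TIsomorphic.local_mulVec_eq {W : Submodule ℂ (Option (X × Y) → ℂ)} {v : Y → ℂ}
    (hW : IsTModule (coneGraph G S x) none W)
    (hiso : TIsomorphic (coneGraph G S x) none W (LinearMap.range (liftVec G x α v)))
    (hG : G.Connected) (hT : ActsTridiagonally G x α c a b) (hv : IsCenteredEigenvector S θ v)
    {g : Option (X × Y) → ℂ} (hg : g ∈ W) :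
    (dualIdempotent (coneGraph G S x) none 1 * (coneGraph G S x).adjMatrix ℂ *
      dualIdempotent (coneGraph G S x) none 1) *ᵥ g =
      (c 0 + a 0 + θ) • dualIdempotent (coneGraph G S x) none 1 *ᵥ g := by
  obtain ⟨σ, hσ⟩ := hiso
  have hE := dualIdempotent_mem_terwilligerAlgebra (coneGraph G S x) none 1
  have hL := mul_mem (mul_mem hE (adjMatrix_mem_terwilligerAlgebra (coneGraph G S x) none)) hE
  have h1 := hσ _ hE ⟨g, hg⟩ ⟨_, hW _ hE g hg⟩ rfl
  have h2 := hσ _ hL ⟨g, hg⟩ ⟨_, hW _ hL g hg⟩ rfl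
  obtain ⟨f, hf⟩ := (σ ⟨g, hg⟩).2
  -- The term `c 0` again comes from `0 - 1 = 0` in `ℕ`.
  have hscalar : (dualIdempotent (coneGraph G S x) none 1 * (coneGraph G S x).adjMatrix ℂ *
      dualIdempotent (coneGraph G S x) none 1) *ᵥ liftVec G x α v f =
      (c 0 + a 0 + θ) • dualIdempotent (coneGraph G S x) none 1 *ᵥ liftVec G x α v f := by
    rw [← Matrix.mulVec_mulVec, dualIdempotent_succ_mulVec_liftVec hG 0, ← Matrix.mulVec_mulVec,
      Matrix.mulVec_smul, adjMatrix_mulVec_liftVec hT hv, Matrix.mulVec_smul,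
      dualIdempotent_succ_mulVec_liftVec hG 0, smul_comm]
    simp [tridiagonal]
  rw [hf] at hscalar
  have h3 : σ ⟨_, hW _ hL g hg⟩ = σ ((c 0 + a 0 + θ) • ⟨_, hW _ hE g hg⟩) := by
    refine Subtype.ext (h2.trans (hscalar.trans ?_))
    rw [map_smul, Submodule.coe_smul, h1]
  exact congrArg Subtype.val (σ.injective h3)

theorem eigenvalue_unique_of_hasUniqueThinEndpointOne (hG : G.Connected)
    (hT : ActsTridiagonally G x α c a b)
    (h : HasUniqueThinEndpointOne (coneGraph G S x) none) {θ' : ℂ} {v v' : Y → ℂ}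
    (hv : IsCenteredEigenvector S θ v) (hv0 : v ≠ 0)
    (hv' : IsCenteredEigenvector S θ' v') (hv0' : v' ≠ 0) : θ = θ' := by
  obtain ⟨W, ⟨hW, hend⟩, -, huniq⟩ := h
  have hiso := huniq _ (isIrreducibleTModule_range_liftVec hG hT hv hv0)
    (hasEndpoint_range_liftVec hG hT.weight_ne_zero hv0)
  have hiso' := huniq _ (isIrreducibleTModule_range_liftVec hG hT hv' hv0')
    (hasEndpoint_range_liftVec hG hT.weight_ne_zero hv0')
  obtain ⟨_, ⟨g, hg, rfl⟩, hg0⟩ := (Submodule.ne_bot_iff _).1 hend.1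
  rw [Matrix.mulVecLin_apply] at hg0
  have h1 := (hiso.local_mulVec_eq hW.1 hG hT hv hg).symm.trans
    (hiso'.local_mulVec_eq hW.1 hG hT hv' hg)
  exact add_left_cancel (smul_left_injective ℂ hg0 h1)

end Isomorphism

/-! ### Regular graphs that are scalar on sum-zero vectors -/

section Eigenvalues

variable {Y : Type*} [Fintype Y] [DecidableEq Y] {S : SimpleGraph Y} [DecidableRel S.Adj]

/-- If all nonzero centered eigenvectors of a regular graph have the same eigenvalue, then its
adjacency matrix is scalar on the orthogonal complement of the all-ones vector. -/
theorem exists_mulVec_eq_smul_of_unique_eigenvalue {k : ℕ} (hk : S.IsRegularOfDegree k)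
    (huniq : ∀ θ θ' (v v' : Y → ℂ), IsCenteredEigenvector S θ v → v ≠ 0 →
      IsCenteredEigenvector S θ' v' → v' ≠ 0 → θ = θ') :
    ∃ θ : ℂ, ∀ u : Y → ℂ, ∑ y, u y = 0 → S.adjMatrix ℂ *ᵥ u = θ • u := by
  obtain ⟨θ, hθ⟩ : ∃ θ : ℂ, ∀ θ' v, IsCenteredEigenvector S θ' v → v ≠ 0 → θ' = θ := by
    by_cases h : ∃ (θ : ℂ) (v : Y → ℂ), IsCenteredEigenvector S θ v ∧ v ≠ 0
    · obtain ⟨θ, v, hv, hv0⟩ := h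
      exact ⟨θ, fun θ' v' hv' hv0' => huniq _ _ _ _ hv' hv0' hv hv0⟩
    · exact ⟨0, fun θ' v' hv' hv0' => (h ⟨θ', v', hv', hv0'⟩).elim⟩
  refine ⟨θ, fun u hu => ?_⟩
  set A := S.adjMatrix ℂ with hAdef
  have hA : A.IsHermitian := by
    ext i j
    simp [hAdef, SimpleGraph.adjMatrix_apply, apply_ite, SimpleGraph.adj_comm]
  have hone : A *ᵥ 1 = (k : ℂ) • 1 := by
    ext y
    exact SimpleGraph.adjMatrix_mulVec_const_apply_of_regular (a := (1 : ℂ)) hk (v := y)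
  have hsum : ∀ b : Y → ℂ, ∑ y, (A *ᵥ b) y = k * ∑ y, b y := by
    intro b
    have h1 : (1 : Y → ℂ) ᵥ* A = (k : ℂ) • 1 := by
      rw [← Matrix.mulVec_transpose, SimpleGraph.transpose_adjMatrix, hone]
    have h2 := Matrix.dotProduct_mulVec (1 : Y → ℂ) A b
    rw [h1, smul_dotProduct, one_dotProduct, one_dotProduct] at h2
    simpa using h2
  -- `m` is the mean, and `P` projects onto sum-zero vectors along the constants.
  let m : (Y → ℂ) →ₗ[ℂ] ℂ := (Fintype.card Y : ℂ)⁻¹ • ∑ y, LinearMap.proj y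
  have hm : ∀ b, m b = (Fintype.card Y : ℂ)⁻¹ * ∑ y, b y := fun b => by simp [m]
  let P : (Y → ℂ) →ₗ[ℂ] (Y → ℂ) := LinearMap.id - m.smulRight 1
  have hP : ∀ b, P b = b - m b • 1 := fun b => rfl
  -- On an eigenbasis of `A`, each `P b` is zero or a centered eigenvector with the eigenvalue of
  -- `b`, which must then be `θ`.
  have key : A.mulVecLin ∘ₗ P = θ • P := by
    refine (hA.eigenvectorBasis.toBasis.map (WithLp.linearEquiv 2 ℂ (Y → ℂ))).ext fun j => ?_
    set b : Y → ℂ := (hA.eigenvectorBasis.toBasis.map (WithLp.linearEquiv 2 ℂ (Y → ℂ))) j with hb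
    have hAb : A *ᵥ b = (hA.eigenvalues j : ℂ) • b := by
      simpa [hb] using hA.mulVec_eigenvectorBasis j
    have hbsum : (k : ℂ) * ∑ y, b y = hA.eigenvalues j * ∑ y, b y := by
      rw [← hsum, hAb]
      simp [Finset.mul_sum]
    have hAP : A *ᵥ P b = (hA.eigenvalues j : ℂ) • P b := by
      rw [hP, Matrix.mulVec_sub, Matrix.mulVec_smul, hAb, hone, smul_sub, smul_smul, smul_smul, hm]
      congr 2
      linear_combination (Fintype.card Y : ℂ)⁻¹ * hbsum
    have hPsum : ∑ y, P b y = 0 := by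
      rcases isEmpty_or_nonempty Y with hY | hY <;> simp [hP, hm]
    change A *ᵥ P b = θ • P b
    by_cases h0 : P b = 0
    · simp [h0]
    · rw [hAP, hθ _ _ ⟨hAP, hPsum⟩ h0]
  have hPu : P u = u := by simp [hP, hm, hu]
  have := LinearMap.congr_fun key u
  simpa [hPu] using this

/-- Coordinate `y` of the equation for `e_y - e_y'` says that the `(y, y')` entry is `-θ`. -/
theorem eq_bot_or_eq_top_of_mulVec_eq_smul {θ : ℂ}
    (h : ∀ u : Y → ℂ, ∑ y, u y = 0 → S.adjMatrix ℂ *ᵥ u = θ • u) : S = ⊥ ∨ S = ⊤ := by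
  have key : ∀ y y', y ≠ y' → (if S.Adj y y' then (1 : ℂ) else 0) = -θ := by
    intro y y' hne
    have h1 := congrFun (h (Pi.single y 1 - Pi.single y' 1) (by simp)) y
    rw [Matrix.mulVec_sub] at h1
    simp [hne] at h1
    rw [← h1]
    simp
  by_cases hθ : θ = 0
  · left
    ext y y'
    simp only [SimpleGraph.bot_adj, iff_false]
    intro hadj
    have := key y y' hadj.ne
    simp [hadj, hθ] at this
  · right
    ext y y'
    refine ⟨fun hadj => hadj.ne, fun hne => ?_⟩
    by_contra hadj
    have := key y y' hne
    simp [hadj] at this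
    exact hθ this

theorem exists_mulVec_eq_smul_of_iso
    (h : (∃ n : ℕ, 2 ≤ n ∧ Nonempty (S ≃g (⊥ : SimpleGraph (Fin n)))) ∨
      (∃ n : ℕ, 2 ≤ n ∧ Nonempty (S ≃g (⊤ : SimpleGraph (Fin n))))) :
    ∃ θ : ℂ, ∀ u : Y → ℂ, ∑ y, u y = 0 → S.adjMatrix ℂ *ᵥ u = θ • u := by
  rcases h with ⟨n, -, ⟨e⟩⟩ | ⟨n, -, ⟨e⟩⟩
  · have hadj : ∀ y y', ¬S.Adj y y' := fun y y' h => by simpa using e.map_adj_iff.2 h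
    refine ⟨0, fun u _ => ?_⟩
    ext y
    simp [Matrix.mulVec, dotProduct, SimpleGraph.adjMatrix_apply, hadj]
  · have hadj : ∀ y y', S.Adj y y' ↔ y ≠ y' := fun y y' => by simp [← e.map_adj_iff]
    refine ⟨-1, fun u hu => ?_⟩
    ext y
    have hterm : ∀ y', (if y ≠ y' then (1 : ℂ) else 0) * u y' =
        u y' - if y = y' then u y' else 0 := by
      intro y'
      by_cases h : y = y' <;> simp [h]
    simp only [Matrix.mulVec, dotProduct, SimpleGraph.adjMatrix_apply, hadj, hterm,
      Finset.sum_sub_distrib, hu]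
    simp

end Eigenvalues

end TerwilligerGraph

/-! ### The equivalence -/

open Matrix TerwilligerGraph

theorem mainTheorem2 {X Y : Type*} [Fintype X] [DecidableEq X] [Fintype Y] [DecidableEq Y]
    (G : SimpleGraph X) (hG : G.Connected) (x : X)
    (hx : TerwilligerGraph.IsPseudoDistanceRegularAround G x)
    (S : SimpleGraph Y) [DecidableRel S.Adj] (hS : ∃ k : ℕ, S.IsRegularOfDegree k)
    (hY : 2 ≤ Fintype.card Y) :
    TerwilligerGraph.HasUniqueThinEndpointOne (TerwilligerGraph.coneGraph G S x) none ↔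
      (∃ n : ℕ, 2 ≤ n ∧ Nonempty (S ≃g (⊥ : SimpleGraph (Fin n)))) ∨
      (∃ n : ℕ, 2 ≤ n ∧ Nonempty (S ≃g (⊤ : SimpleGraph (Fin n)))) := by
  obtain ⟨α, c, a, b, hT⟩ := hx.exists_actsTridiagonally hG
  constructor
  · intro h
    obtain ⟨k, hk⟩ := hS
    obtain ⟨θ, hθ⟩ := exists_mulVec_eq_smul_of_unique_eigenvalue hk
      fun _ _ _ _ hv hv0 hv' hv0' =>
        eigenvalue_unique_of_hasUniqueThinEndpointOne hG hT h hv hv0 hv' hv0'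
    refine (eq_bot_or_eq_top_of_mulVec_eq_smul hθ).imp (fun hbot => ?_) (fun htop => ?_)
    · exact ⟨_, hY, ⟨⟨Fintype.equivFin Y, by simp [hbot]⟩⟩⟩
    · exact ⟨_, hY, ⟨⟨Fintype.equivFin Y, by simp [htop]⟩⟩⟩
  · intro h
    obtain ⟨θ, hθ⟩ : ∃ θ : ℂ, ∀ u : Y → ℂ, ∑ y, u y = 0 → S.adjMatrix ℂ *ᵥ u = θ • u :=
      exists_mulVec_eq_smul_of_iso h
    -- Two distinct vertices of `S` supply the nonzero sum-zero vector whose lift is the required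
    -- module.
    obtain ⟨y, y', hne⟩ := Fintype.one_lt_card_iff.1 (show 1 < Fintype.card Y from hY)
    have hsum : ∑ z, (Pi.single y 1 - Pi.single y' 1 : Y → ℂ) z = 0 := by simp
    have hv : IsCenteredEigenvector S θ (Pi.single y 1 - Pi.single y' 1) := ⟨hθ _ hsum, hsum⟩
    have hv0 : (Pi.single y 1 - Pi.single y' 1 : Y → ℂ) ≠ 0 :=
      Function.ne_iff.2 ⟨y, by simp [hne]⟩
    refine ⟨_, ⟨isIrreducibleTModule_range_liftVec hG hT hv hv0,
      hasEndpoint_range_liftVec hG hT.weight_ne_zero hv0⟩, isThin_range_liftVec hG,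
      fun W hW hend => ?_⟩
    obtain ⟨u, hu, hu0, rfl⟩ := hW.eq_range_liftVec hend hG hT hθ
    exact tIsomorphic_range_liftVec hG hT hv hu hv0 hu0
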